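/- **Conventions.** For possibly undefined expressions, $e'\preceq e$ means: if $e$ is defined, then $e'$ is defined and $e'\le e$; moreover $e\le a$ means that $e$ is defined and its value is $\le a$. A *partial applicative poset* (PAP) is a poset $A$ with a partial binary application map such that $a'\le a$, $b'\le b$ imply $a'b'\preceq ab$. A *filter* of a PAP is a non-empty, upwards closed subset that contains $ab$ whenever it contains $a,b$ and $ab$ is defined; $\langle X\rangle$ denotes the least filter containing the non-empty set $X$. A (relative, ordered) *PCA* is a PAP $A$ with a filter $A^\#$ and (chosen) elements $\mathsf k,\mathsf s\in A^\#$ such that $\mathsf kab\le a$, $\mathsf sab$ is defined, and $\mathsf sabc\preceq ac(bc)$ for all $a,b,c\in A$. It is *discrete* if its order is equality. From $\mathsf k,\mathsf s$ one defines $\mathsf i=\mathsf{skk}$, $\top=\mathsf k$, $\bot=\mathsf{ki}$, by the usual bracket abstraction $\mathsf p=\lambda^*xyz.zxy$, $\mathsf p_0=\lambda^*x.x\top$, $\mathsf p_1=\lambda^*x.x\bot$, numerals $\overline 0=\mathsf i$, $\overline{n+1}=\mathsf p\bot\overline n$, tuples $j()=\mathsf i$, $j(a_0,\dots,a_n)=\mathsf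 pa_0\,j(a_1,\dots,a_n)$, and codes of sequences $[a_0,\dots,a_{n-1}]=\mathsf p\,\overline n\,j(a_0,\dots,a_{n-1})$. $A$ is *semitrivial* if $\top,\bot$ have a common lower bound. Let $A$ be a PCA that is not semitrivial. $\mathcal BA$ is the set of partial functions $\alpha\colon A\rightharpoonup A$ such that $a\le b$ implies $\alpha(a)\preceq\alpha(b)$, ordered by $\alpha\le\beta$ iff $\alpha(a)\preceq\beta(a)$ for all $a$. It is a PAP with the total application $(\alpha,\beta)\mapsto\alpha\beta$, where $\alpha\beta(a)=b$ iff there is a finite sequence $u_0,\dots,u_{n-1}$ in $A$ with * $\mathsf p_0\cdot\alpha([a,u_0,\dots,u_{i-1}])\le\bot$ and $\beta(\mathsf p_1\cdot\alpha([a,u_0,\dots,u_{i-1}]))=u_i$ for all $i<n$; * $\mathsf p_0\cdot\alpha([a,u_0,\dots,u_{n-1}])\le\top$ and $\mathsf p_1\cdot\alpha([a,u_0,\dots,u_{n-1}])=b$. Put $(\mathcal BA)^\#=\{\alpha\in\mathcal BA\mid\exists r\in A^\#\ \forall a\in A\ (ra\preceq\alpha(a))\}$. For a PCA $B$, let $DB$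 be the set of downwards closed subsets of $B$. For $X,Y\in DB$, $XY$ is defined iff $xy$ is defined for all $x\in X,y\in Y$, and is then the downwards closure of $\{xy\mid x\in X,y\in Y\}$; for $b\in B$ write $b\cdot X$ for $({\downarrow}\{b\})X$. A *partial applicative morphism* $g\colon A\rightharpoonup B$ is a function $g\colon A\to DB$ such that 1. $g(a)\cap B^\#\ne\emptyset$ for $a\in A^\#$; 2. for some $t\in B^\#$: whenever $aa'$ is defined, $t\cdot g(a)\cdot g(a')$ is defined and contained in $g(aa')$; 3. for some $u\in B^\#$: $u\cdot g(a)$ is defined for all $a$, and contained in $g(a')$ whenever $a\le a'$. Write $g\le g'$ if for some $s\in B^\#$, $s\cdot g(a)$ is defined and contained in $g'(a)$ for all $a\in A$, and $g\simeq g'$ if $g\le g'$ and $g'\le g$. The morphism $g$ is * *total* if $g(a)\neq\emptyset$ for all $a$; * *discrete* if $g(a)\cap g(a')=\emptyset$ for all $a\ne a'$; * *projective* if $g\simeq g'$ for a partial applicative morphism $g'\colon A\rightharpoonup B$ such that every non-empty $g'(a)$ is a principal downset; * *computationally dense* if there is $n\in B^\#$ such that for every $s\in B^\#$ there is $r\in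 A^\#$ for which $n\cdot g(r)$ is defined and contained in ${\downarrow}\{s\}$. A function $\alpha\in\mathcal BA$ is *effectively representable with respect to $g$* if there is $s\in B^\#$ such that $s\cdot g(a)$ is defined and contained in $g(\alpha(a))$ for all $a$ in the domain of $\alpha$. **Lemma.** Let $A$ be a discrete PCA that is not semitrivial, let $B$ be a PCA, and let $g\colon A\to B$ be a total applicative morphism that is discrete, projective and computationally dense. Then there exists $f\in\mathcal BA$ such that $$\{\alpha\in\mathcal BA\mid\alpha\text{ is effectively representable with respect to }g\}=\langle(\mathcal BA)^\#\cup\{f\}\rangle,$$ where the generated filter is taken in the PAP $\mathcal BA$. -/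

import Mathlib

universe u v

namespace RelPCA



section Kleene

variable {A : Type u} [PartialOrder A]

/-- `e' ≼ e` for possibly undefined elements: if `e` is defined, then so is `e'`, and `e' ≤ e`. -/
def Refines (e' e : Part A) : Prop := ∀ a ∈ e, ∃ a' ∈ e', a' ≤ a

/-- `e ≤ a` for a possibly undefined `e`: `e` is defined, and its value is below `a`. -/
def IsBelow (e : Part A) (a : A) : Prop := ∃ x ∈ e, x ≤ a

theorem Refines.rfl {e : Part A} : Refines e e := fun a ha => ⟨a, ha, le_rfl⟩

theorem Refines.trans {e e' e'' : Part A} (h : Refines e e') (h' : Refines e' e'') :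
    Refines e e'' := by
  intro a ha
  obtain ⟨b, hb, hba⟩ := h' a ha
  obtain ⟨c, hc, hcb⟩ := h b hb
  exact ⟨c, hc, hcb.trans hba⟩

theorem Refines.dom {e e' : Part A} (h : Refines e e') (h' : e'.Dom) : e.Dom := by
  obtain ⟨c, hc, -⟩ := h _ (Part.get_mem h')
  exact Part.dom_iff_mem.2 ⟨c, hc⟩

theorem IsBelow.mono {e e' : Part A} {a : A} (h : Refines e' e) (h' : IsBelow e a) :
    IsBelow e' a := by
  obtain ⟨x, hx, hxa⟩ := h'
  obtain ⟨y, hy, hyx⟩ := h x hx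
  exact ⟨y, hy, hyx.trans hxa⟩

end Kleene

/-- A partial applicative poset: a poset with a partial application map that has downwards closed
domain and preserves the order. -/
class PAP (A : Type u) [PartialOrder A] where
  /-- the partial application map -/
  app : A → A → Part A
  app_mono : ∀ {a a' b b' : A}, a' ≤ a → b' ≤ b → Refines (app a' b') (app a b)

infixl:70 " ⬝ " => PAP.app

/-- The order is discrete. -/
def IsDiscrete (A : Type u) [PartialOrder A] : Prop := ∀ a b : A, a ≤ b → a = b

section Filters

variable {A : Type u} [PartialOrder A] [PAP A]

/-- Filters of a partial applicative poset. -/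
structure IsFilter (F : Set A) : Prop where
  nonempty : F.Nonempty
  app_mem : ∀ a ∈ F, ∀ b ∈ F, ∀ c ∈ a ⬝ b, c ∈ F
  upward : ∀ a ∈ F, ∀ b, a ≤ b → b ∈ F

/-- The filter `⟨X⟩` generated by a (non-empty) set `X`. -/
def filterGen (X : Set A) : Set A := ⋂₀ {F | IsFilter F ∧ X ⊆ F}

theorem filterGen_isLeast {X : Set A} (hX : X.Nonempty) :
    IsLeast {F | IsFilter F ∧ X ⊆ F} (filterGen X) := by
  refine ⟨⟨⟨?_, ?_, ?_⟩, ?_⟩, ?_⟩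
  · obtain ⟨x, hx⟩ := hX
    exact ⟨x, fun F hF => hF.2 hx⟩
  · exact fun a ha b hb c hc F hF => hF.1.app_mem a (ha F hF) b (hb F hF) c hc
  · exact fun a ha b hab F hF => hF.1.upward a (ha F hF) b hab
  · exact fun x hx F hF => hF.2 hx
  · exact fun F hF => Set.sInter_subset_of_mem hF

/-- Application of possibly undefined elements. -/
def papp (e e' : Part A) : Part A := e.bind fun x => e'.bind fun y => x ⬝ y

theorem mem_papp {e e' : Part A} {c : A} :
    c ∈ papp e e' ↔ ∃ x ∈ e, ∃ y ∈ e', c ∈ x ⬝ y := by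
  simp [papp, Part.mem_bind_iff]

theorem papp_mono {e e' d d' : Part A} (h : Refines e' e) (h' : Refines d' d) :
    Refines (papp e' d') (papp e d) := by
  intro c hc
  obtain ⟨x, hx, y, hy, hxy⟩ := mem_papp.1 hc
  obtain ⟨x', hx', hxx⟩ := h x hx
  obtain ⟨y', hy', hyy⟩ := h' y hy
  obtain ⟨c', hc', hcc⟩ := PAP.app_mono hxx hyy c hxy
  exact ⟨c', mem_papp.2 ⟨x', hx', y', hy', hc'⟩, hcc⟩

end Filters

/-- The partial applicative poset `DA` of downwards closed subsets of `A`: `αβ` is defined when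
`ab` is defined for all `a ∈ α`, `b ∈ β`, and it is then the downwards closure of all these `ab`. -/
instance instPAPLowerSet {A : Type u} [PartialOrder A] [PAP A] : PAP (LowerSet A) where
  app X Y := ⟨∀ a ∈ X, ∀ b ∈ Y, (a ⬝ b).Dom,
    fun _ => lowerClosure {c | ∃ a ∈ X, ∃ b ∈ Y, c ∈ a ⬝ b}⟩
  app_mono := by
    rintro X X' Y Y' hX hY Z ⟨hZ, rfl⟩
    refine ⟨_, ⟨fun a ha b hb => hZ a (hX ha) b (hY hb), rfl⟩, ?_⟩
    refine lowerClosure_mono ?_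
    rintro c ⟨a, ha, b, hb, hc⟩
    exact ⟨a, hX ha, b, hY hb, hc⟩

/-- A (relative, ordered) partial combinatory algebra, with its filter `sharp` of computable
elements (written `A^#`) and a choice of the combinators `k` and `s` in it. -/
class PCA (A : Type u) [PartialOrder A] extends PAP A where
  /-- the filter of computable elements -/
  sharp : Set A
  sharp_isFilter : IsFilter sharp
  k : A
  s : A
  k_mem : k ∈ sharp
  s_mem : s ∈ sharp
  k_app : ∀ a b : A, IsBelow (papp (k ⬝ a) (Part.some b)) a
  s_dom : ∀ a b : A, (papp (s ⬝ a) (Part.some b)).Dom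
  s_app : ∀ a b c : A,
    Refines (papp (papp (s ⬝ a) (Part.some b)) (Part.some c)) (papp (a ⬝ c) (b ⬝ c))

section Combinators

variable {A : Type u} [PartialOrder A] [PCA A]

open PCA (k s)

theorem k_dom (a : A) : (k ⬝ a).Dom := by
  obtain ⟨c, hc, -⟩ := PCA.k_app a a
  obtain ⟨x, hx, -⟩ := mem_papp.1 hc
  exact Part.dom_iff_mem.2 ⟨x, hx⟩

variable (A) in
/-- `i = skk` -/
def iC : A := (papp (s ⬝ k) (Part.some k)).get (PCA.s_dom k k)

theorem i_app (a : A) : IsBelow (iC A ⬝ a) a := by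
  have hi : iC A ∈ papp (s ⬝ (k : A)) (Part.some k) := Part.get_mem _
  obtain ⟨c, hc, -⟩ := PCA.k_app a ((k ⬝ a).get (k_dom a))
  have hca : c ∈ papp (k ⬝ a) (k ⬝ a) := by
    obtain ⟨x, hx, y, hy, hxy⟩ := mem_papp.1 hc
    obtain rfl := Part.mem_some_iff.1 hy
    exact mem_papp.2 ⟨x, hx, _, Part.get_mem _, hxy⟩
  obtain ⟨d, hd, hdc⟩ := PCA.s_app k k a c hca
  obtain ⟨x, hx, y, hy, hxy⟩ := mem_papp.1 hd
  rw [Part.mem_some_iff.1 hy, Part.mem_unique hx hi] at hxy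
  obtain ⟨e, he, hea⟩ := PCA.k_app a ((k ⬝ a).get (k_dom a))
  exact ⟨d, hxy, hdc.trans ((Part.mem_unique hc he) ▸ hea)⟩

/-- Terms over `A`, with variables indexed by `ℕ`. -/
inductive Term (A : Type u) : Type u
  | var : ℕ → Term A
  | const : A → Term A
  | app : Term A → Term A → Term A

/-- The possibly undefined interpretation of a term. -/
def Term.eval (ρ : ℕ → A) : Term A → Part A
  | .var n => Part.some (ρ n)
  | .const a => Part.some a
  | .app t₀ t₁ => papp (t₀.eval ρ) (t₁.eval ρ)

/-- The term `λ* x. t`. -/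
def Term.lam (x : ℕ) : Term A → Term A
  | .var n => if n = x then .const (iC A) else .app (.const k) (.var n)
  | .const a => .app (.const k) (.const a)
  | .app t₀ t₁ => .app (.app (.const s) (t₀.lam x)) (t₁.lam x)

theorem papp_some (a b : A) : papp (Part.some a) (Part.some b) = a ⬝ b := by
  simp [papp]

theorem Term.eval_lam_dom (ρ : ℕ → A) (x : ℕ) (t : Term A) : ((t.lam x).eval ρ).Dom := by
  induction t with
  | var n =>
    by_cases h : n = x
    · simp [Term.lam, h, Term.eval]
    · simp only [Term.lam, h, if_false, Term.eval, papp_some]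
      exact k_dom _
  | const a =>
    simp only [Term.lam, Term.eval, papp_some]
    exact k_dom _
  | app t₀ t₁ h₀ h₁ =>
    obtain ⟨a, ha⟩ := Part.dom_iff_mem.1 h₀
    obtain ⟨b, hb⟩ := Part.dom_iff_mem.1 h₁
    simp only [Term.lam, Term.eval, Part.eq_some_iff.2 ha, Part.eq_some_iff.2 hb]
    rw [papp_some]
    exact PCA.s_dom a b

theorem Term.eval_lam_app (ρ : ℕ → A) (x : ℕ) (t : Term A) (c : A) :
    Refines (papp ((t.lam x).eval ρ) (Part.some c)) (t.eval (Function.update ρ x c)) := by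
  induction t with
  | var n =>
    by_cases h : n = x
    · subst h
      intro d hd
      simp only [Term.eval, Function.update_self, Part.mem_some_iff] at hd
      subst hd
      simpa [Term.lam, Term.eval, papp_some, IsBelow] using i_app d
    · intro d hd
      simp only [Term.eval, Function.update_of_ne h, Part.mem_some_iff] at hd
      subst hd
      simpa [Term.lam, h, Term.eval, papp_some, IsBelow] using PCA.k_app (ρ n) c
  | const a =>
    intro d hd
    simp only [Term.eval, Part.mem_some_iff] at hd
    subst hd
    simpa [Term.lam, Term.eval, papp_some, IsBelow] using PCA.k_app d c
  | app t₀ t₁ h₀ h₁ =>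
    obtain ⟨a, ha⟩ := Part.dom_iff_mem.1 (Term.eval_lam_dom ρ x t₀)
    obtain ⟨b, hb⟩ := Part.dom_iff_mem.1 (Term.eval_lam_dom ρ x t₁)
    rw [Part.eq_some_iff.2 ha, papp_some] at h₀
    rw [Part.eq_some_iff.2 hb, papp_some] at h₁
    simp only [Term.lam, Term.eval, Part.eq_some_iff.2 ha, Part.eq_some_iff.2 hb]
    rw [papp_some]
    exact (PCA.s_app a b c).trans (papp_mono h₀ h₁)

/-- The element of `A` denoted by `λ* x. t`, when `x` is the only variable of `t`. -/
def lamC (x : ℕ) (t : Term A) : A :=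
  ((t.lam x).eval fun _ => k).get (Term.eval_lam_dom _ x t)

variable (A) in
/-- `⊤ = k` -/
def tt : A := k

variable (A) in
/-- `⊥ = ki` -/
def ff : A := ((k : A) ⬝ iC A).get (k_dom _)

variable (A) in
/-- The pairing combinator `p = λ* x y z. z x y`. -/
def pC : A :=
  lamC 0 (.lam 1 (.lam 2 (.app (.app (.var 2) (.var 0)) (.var 1))))

variable (A) in
/-- The first unpairing combinator `p₀ = λ* x. x k`. -/
def p₀ : A := lamC 0 (.app (.var 0) (.const (tt A)))

variable (A) in
/-- The second unpairing combinator `p₁ = λ* x. x (k i)`. -/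
def p₁ : A := lamC 0 (.app (.var 0) (.const (ff A)))

theorem pair_dom (a b : A) : (papp (pC A ⬝ a) (Part.some b)).Dom := by
  set t : Term A := .app (.app (.var 2) (.var 0)) (.var 1) with ht
  have hp : pC A ∈ (Term.lam 0 (.lam 1 (.lam 2 t))).eval fun _ => (k : A) := Part.get_mem _
  have h1 := Term.eval_lam_app (fun _ => (k : A)) 0 (.lam 1 (.lam 2 t)) a
  rw [Part.eq_some_iff.2 hp, papp_some] at h1
  have h2 := (papp_mono h1 (Refines.rfl (e := Part.some b))).trans
    (Term.eval_lam_app _ 1 (.lam 2 t) b)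
  exact h2.dom (Term.eval_lam_dom _ _ _)

/-- The pair `pab`. -/
def pair (a b : A) : A := (papp (pC A ⬝ a) (Part.some b)).get (pair_dom a b)

variable (A) in
/-- Numerals: `0` is coded by `i`, and `n + 1` by `p ⊥ n`. -/
def num : ℕ → A
  | 0 => iC A
  | n + 1 => pair (ff A) (num n)

/-- `j() = i` and `j(a₀, …, aₙ) = p a₀ (j(a₁, …, aₙ))`. -/
def tuple : List A → A
  | [] => iC A
  | a :: l => pair a (tuple l)

/-- The code `[a₀, …, aₙ₋₁] = p n (j(a₀, …, aₙ₋₁))` of a finite sequence. -/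
def code (l : List A) : A := pair (num A l.length) (tuple l)

theorem pair_mono {a a' b b' : A} (ha : a' ≤ a) (hb : b' ≤ b) : pair a' b' ≤ pair a b := by
  have h : Refines (papp (pC A ⬝ a') (Part.some b')) (papp (pC A ⬝ a) (Part.some b)) := by
    refine papp_mono (PAP.app_mono le_rfl ha) ?_
    intro c hc
    obtain rfl := Part.mem_some_iff.1 hc
    exact ⟨b', Part.mem_some _, hb⟩
  obtain ⟨c, hc, hle⟩ := h _ (Part.get_mem (pair_dom a b))
  rw [← Part.get_eq_of_mem hc (pair_dom a' b')] at hle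
  exact hle

theorem tuple_mono {l' l : List A} (h : List.Forall₂ (· ≤ ·) l' l) : tuple l' ≤ tuple l := by
  induction h with
  | nil => exact le_rfl
  | cons h _ ih => exact pair_mono h ih

theorem code_mono {l' l : List A} (h : List.Forall₂ (· ≤ ·) l' l) : code l' ≤ code l := by
  unfold code
  rw [h.length_eq]
  exact pair_mono le_rfl (tuple_mono h)

end Combinators

/-- A PCA is semitrivial if its booleans have a common lower bound. -/
def Semitrivial (A : Type u) [PartialOrder A] [PCA A] : Prop := ∃ x : A, x ≤ tt A ∧ x ≤ ff A

/-- A PCA that is not semitrivial. -/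
class NonSemitrivial (A : Type u) [PartialOrder A] [PCA A] : Prop where
  not_semitrivial : ¬ Semitrivial A

/-- The set `𝓑A` of partial functions `α` on `A` such that `a ≤ b` implies `α(a) ≼ α(b)`. -/
@[ext]
structure BFun (A : Type u) [PartialOrder A] where
  toFun : A →. A
  mono : ∀ a b : A, a ≤ b → Refines (toFun a) (toFun b)

section BFun

variable {A : Type u} [PartialOrder A]

/-- `α ≤ β` in `𝓑A` when `α(a) ≼ β(a)` for all `a`. -/
instance instPartialOrderBFun : PartialOrder (BFun A) where
  le α β := ∀ a, Refines (α.toFun a) (β.toFun a)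
  le_refl _ _ a h := ⟨a, h, le_rfl⟩
  le_trans α β γ h h' a c hc := by
    obtain ⟨b, hb, hbc⟩ := h' a c hc
    obtain ⟨d, hd, hdb⟩ := h a b hb
    exact ⟨d, hd, hdb.trans hbc⟩
  le_antisymm α β h h' := by
    refine BFun.ext (funext fun a => Part.ext fun c => ?_)
    constructor
    · intro hc
      obtain ⟨b, hb, hbc⟩ := h' a c hc
      obtain ⟨d, hd, hdb⟩ := h a b hb
      obtain rfl := Part.mem_unique hc hd
      exact (hbc.antisymm hdb) ▸ hb
    · intro hc
      obtain ⟨b, hb, hbc⟩ := h a c hc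
      obtain ⟨d, hd, hdb⟩ := h' a b hb
      obtain rfl := Part.mem_unique hc hd
      exact (hbc.antisymm hdb) ▸ hb

variable [PCA A]

/-- `u₀, …, uₙ₋₁` are the oracle values returned by `β` when interrogated by `α` on input `a`:
for all `i < n`, `p₀ · α([a, u₀, …, uᵢ₋₁]) ≤ ⊥` and `β(p₁ · α([a, u₀, …, uᵢ₋₁])) = uᵢ`. -/
def IsInterrogation (α β : BFun A) (a : A) (us : List A) : Prop :=
  ∀ (i : ℕ) (hi : i < us.length), ∃ c ∈ α.toFun (code (a :: us.take i)),
    IsBelow (p₀ A ⬝ c) (ff A) ∧ ∃ q ∈ p₁ A ⬝ c, us[i] ∈ β.toFun q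

/-- `αβ(a) = b`: there is an interrogation `u₀, …, uₙ₋₁` such that
`p₀ · α([a, u₀, …, uₙ₋₁]) ≤ ⊤` and `p₁ · α([a, u₀, …, uₙ₋₁]) = b`. -/
def BAppRel (α β : BFun A) (a b : A) : Prop :=
  ∃ us : List A, IsInterrogation α β a us ∧ ∃ c ∈ α.toFun (code (a :: us)),
    IsBelow (p₀ A ⬝ c) (tt A) ∧ b ∈ p₁ A ⬝ c

theorem isBelow_not_both [NonSemitrivial A] {e : Part A} (h : IsBelow e (tt A))
    (h' : IsBelow e (ff A)) : False := by
  obtain ⟨x, hx, hxt⟩ := h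
  obtain ⟨y, hy, hyt⟩ := h'
  obtain rfl := Part.mem_unique hx hy
  exact NonSemitrivial.not_semitrivial (A := A) ⟨x, hxt, hyt⟩

theorem BAppRel.unique [NonSemitrivial A] {α β : BFun A} {a b b' : A}
    (h : BAppRel α β a b) (h' : BAppRel α β a b') : b = b' := by
  obtain ⟨us, hus, c, hc, hct, hb⟩ := h
  obtain ⟨vs, hvs, d, hd, hdt, hb'⟩ := h'
  have key : ∀ n, n ≤ us.length → n ≤ vs.length → us.take n = vs.take n := by
    intro n
    induction n with
    | zero => intros; simp
    | succ n ih =>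
      intro hn hm
      have ih' := ih (by omega) (by omega)
      obtain ⟨x, hx, -, q, hq, hqu⟩ := hus n (by omega)
      obtain ⟨y, hy, -, r, hr, hrv⟩ := hvs n (by omega)
      rw [ih'] at hx
      obtain rfl := Part.mem_unique hx hy
      obtain rfl := Part.mem_unique hq hr
      rw [List.take_succ_eq_append_getElem (by omega), List.take_succ_eq_append_getElem (by omega),
        ih', Part.mem_unique hqu hrv]
  have hlen : us.length = vs.length := by
    rcases lt_trichotomy us.length vs.length with hl | hl | hl
    · exfalso
      obtain ⟨y, hy, hyf, -⟩ := hvs us.length hl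
      rw [← key us.length le_rfl hl.le, List.take_length] at hy
      obtain rfl := Part.mem_unique hc hy
      exact isBelow_not_both hct hyf
    · exact hl
    · exfalso
      obtain ⟨y, hy, hyf, -⟩ := hus vs.length hl
      rw [key vs.length hl.le le_rfl, List.take_length] at hy
      obtain rfl := Part.mem_unique hd hy
      exact isBelow_not_both hdt hyf
  have huv : us = vs := by
    have := key us.length le_rfl hlen.le
    rwa [List.take_length, hlen, List.take_length] at this
  subst huv
  obtain rfl := Part.mem_unique hc hd
  exact Part.mem_unique hb hb'

theorem BFun.refines {α α' : BFun A} {a a' : A} (hα : α' ≤ α) (ha : a' ≤ a) :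
    Refines (α'.toFun a') (α.toFun a) :=
  (α'.mono a' a ha).trans (hα a)

theorem BAppRel.mono {α α' β β' : BFun A} {a a' b : A} (hα : α' ≤ α) (hβ : β' ≤ β)
    (ha : a' ≤ a) (h : BAppRel α β a b) : ∃ b', BAppRel α' β' a' b' ∧ b' ≤ b := by
  obtain ⟨us, hus, c, hc, hct, hb⟩ := h
  have key : ∀ n, n ≤ us.length →
      ∃ vs, IsInterrogation α' β' a' vs ∧ List.Forall₂ (· ≤ ·) vs (us.take n) := by
    intro n
    induction n with
    | zero => exact fun _ => ⟨[], fun i hi => absurd hi (by simp), by simp⟩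
    | succ n ih =>
      intro hn
      obtain ⟨vs, hvs, hle⟩ := ih (by omega)
      have hvl : vs.length = n := by
        rw [hle.length_eq, List.length_take]; omega
      obtain ⟨x, hx, hxf, q, hq, hqu⟩ := hus n (by omega)
      obtain ⟨x', hx', hxx⟩ := BFun.refines hα (code_mono (List.Forall₂.cons ha hle)) x hx
      obtain ⟨q', hq', hqq⟩ := PAP.app_mono (le_refl (p₁ A)) hxx q hq
      obtain ⟨w, hw, hwu⟩ := BFun.refines hβ hqq _ hqu
      refine ⟨vs ++ [w], ?_, ?_⟩
      · intro i hi
        rw [List.length_append, List.length_singleton] at hi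
        rcases Nat.lt_or_ge i vs.length with hlt | hge
        · rw [List.take_append_of_le_length hlt.le, List.getElem_append_left hlt]
          exact hvs i hlt
        · obtain rfl : i = vs.length := by omega
          rw [List.take_left, List.getElem_concat_length (by rfl)]
          exact ⟨x', hx', hxf.mono (PAP.app_mono le_rfl hxx), q', hq', hw⟩
      · rw [List.take_succ_eq_append_getElem (by omega)]
        exact List.rel_append hle (List.Forall₂.cons hwu List.Forall₂.nil)
  obtain ⟨vs, hvs, hle⟩ := key us.length le_rfl
  rw [List.take_length] at hle
  obtain ⟨c', hc', hcc⟩ := BFun.refines hα (code_mono (List.Forall₂.cons ha hle)) c hc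
  obtain ⟨b', hb', hbb⟩ := PAP.app_mono (le_refl (p₁ A)) hcc b hb
  exact ⟨b', ⟨vs, hvs, c', hc', hct.mono (PAP.app_mono le_rfl hcc), hb'⟩, hbb⟩

/-- The partial function underlying `αβ`. -/
noncomputable def bappFun (α β : BFun A) : A →. A := fun a =>
  ⟨∃ b, BAppRel α β a b, fun h => h.choose⟩

theorem mem_bappFun [NonSemitrivial A] {α β : BFun A} {a b : A} :
    b ∈ bappFun α β a ↔ BAppRel α β a b := by
  constructor
  · rintro ⟨h, rfl⟩
    exact h.choose_spec
  · exact fun h => ⟨⟨b, h⟩, BAppRel.unique (Exists.choose_spec (⟨b, h⟩ : ∃ b, BAppRel α β a b)) h⟩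

/-- The application `αβ` of `𝓑A`, for `A` not semitrivial. -/
noncomputable def bapp [NonSemitrivial A] (α β : BFun A) : BFun A where
  toFun := bappFun α β
  mono a' a h b hb := by
    obtain ⟨b', hb', hle⟩ := (mem_bappFun.1 hb).mono le_rfl le_rfl h
    exact ⟨b', mem_bappFun.2 hb', hle⟩

/-- `𝓑A` is a total partial applicative poset. -/
noncomputable instance instPAPBFun [NonSemitrivial A] : PAP (BFun A) where
  app α β := Part.some (bapp α β)
  app_mono := by
    intro α α' β β' hα hβ γ hγ
    obtain rfl := Part.mem_some_iff.1 hγ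
    refine ⟨_, Part.mem_some _, fun a b hb => ?_⟩
    obtain ⟨b', hb', hle⟩ := (mem_bappFun.1 hb).mono hα hβ le_rfl
    exact ⟨b', mem_bappFun.2 hb', hle⟩

variable (A) in
/-- `(𝓑A)^#`: the functions `α` represented by some `r ∈ A^#`, i.e. `ra ≼ α(a)` for all `a`. -/
def BFun.sharp : Set (BFun A) := {α | ∃ r ∈ PCA.sharp (A := A), ∀ a, Refines (r ⬝ a) (α.toFun a)}

end BFun

section Morphisms

variable {A : Type u} {B : Type v} [PartialOrder A] [PCA A] [PartialOrder B] [PCA B]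

/-- `bX`, for `b ∈ B` and `X ∈ DB`: the application of the principal downset of `b` to `X`. -/
def dapp (b : B) (X : LowerSet B) : Part (LowerSet B) := LowerSet.Iic b ⬝ X

variable (A B) in
/-- Partial applicative morphisms from `A` to `B`. -/
structure PartialApplicativeMorphism where
  toFun : A → LowerSet B
  sharp : ∀ a ∈ PCA.sharp (A := A), ((toFun a : Set B) ∩ PCA.sharp).Nonempty
  tracker : ∃ t ∈ PCA.sharp (A := B), ∀ a a' : A, ∀ c ∈ a ⬝ a',
    IsBelow (papp (dapp t (toFun a)) (Part.some (toFun a'))) (toFun c)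
  order : ∃ u ∈ PCA.sharp (A := B), (∀ a : A, (dapp u (toFun a)).Dom) ∧
    ∀ a a' : A, a ≤ a' → IsBelow (dapp u (toFun a)) (toFun a')

namespace PartialApplicativeMorphism

/-- `f ≤ f'`: some `s ∈ B^#` is such that `s · f(a)` is defined and contained in `f'(a)`,
for all `a`. -/
def Below (f f' : PartialApplicativeMorphism A B) : Prop :=
  ∃ s ∈ PCA.sharp (A := B), ∀ a, IsBelow (dapp s (f.toFun a)) (f'.toFun a)

/-- `f ≃ f'` -/
def Iso (f f' : PartialApplicativeMorphism A B) : Prop := f.Below f' ∧ f'.Below f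

def IsTotal (f : PartialApplicativeMorphism A B) : Prop := ∀ a, (f.toFun a : Set B).Nonempty

/-- Computational density. -/
def IsCD (f : PartialApplicativeMorphism A B) : Prop :=
  ∃ n ∈ PCA.sharp (A := B), ∀ s ∈ PCA.sharp (A := B), ∃ r ∈ PCA.sharp (A := A),
    IsBelow (dapp n (f.toFun r)) (LowerSet.Iic s)

def IsSingleValued (f : PartialApplicativeMorphism A B) : Prop :=
  ∀ a, (f.toFun a : Set B).Nonempty → ∃ b, f.toFun a = LowerSet.Iic b

def IsProjective (f : PartialApplicativeMorphism A B) : Prop :=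
  ∃ f' : PartialApplicativeMorphism A B, f'.IsSingleValued ∧ f.Iso f'

/-- A morphism is discrete if it has disjoint values at distinct elements. -/
def IsDiscreteMorphism (f : PartialApplicativeMorphism A B) : Prop :=
  ∀ a a', a ≠ a' → (f.toFun a : Set B) ∩ f.toFun a' = ∅

/-- `s ∈ B` represents `α ∈ 𝓑A` with respect to `g`: for all `a` in the domain of `α`, `s · g(a)`
is defined and contained in `g(α(a))`. -/
def Represents (g : PartialApplicativeMorphism A B) (s : B) (α : BFun A) : Prop :=
  ∀ a, ∀ c ∈ α.toFun a, IsBelow (dapp s (g.toFun a)) (g.toFun c)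

def EffectivelyRepresentable (g : PartialApplicativeMorphism A B) (α : BFun A) : Prop :=
  ∃ s ∈ PCA.sharp (A := B), g.Represents s α

end PartialApplicativeMorphism

end Morphisms

end RelPCA

/-! By projectivity `g` is isomorphic to a morphism with principal values, and by totality all of
these are non-empty, hence of the form `↓{γ(a)}` for one function `γ : A → B`. Discreteness of `g`
then says that no element of `B` lies below two distinct `γ(a)`, and density gives `n ∈ B^#` such
that every `s ∈ B^#` has a code `r ∈ A^#` with `n · γ(r) ≤ s`. This reduction is
`exists_isPointMorphism`.

The oracle `f` is a universal function: `f(pra) = c` when `n · γ(r) · γ(a) ≤ γ(c)`, which is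
single-valued by discreteness. If `s` represents `α` and `r` is a code of `s`, then `f(pra) = α(a)`
on the domain of `α`. Smaller elements of `𝓑A` are more defined, so `α` lies above some `mf` with
`m` computable that queries `f` just once (`mem_of_pair`).

For the converse, `f` and all of `(𝓑A)^#` are representable, and it remains to see that
representable functions form a filter. The substantial point is closure under application
(`bapp_mem_pointRepresentable`): a fixed point in `B` runs the dialogue between `α` and the oracle
on an encoded history. It has to branch on Booleans of `A`, which density makes decidable in `B`
(`IsPointMorphism.decides`). -/

namespace RelPCA

section Kleene

variable {A : Type u} [PartialOrder A]

theorem isBelow_some {a b : A} (h : a ≤ b) : IsBelow (Part.some a) b :=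
  ⟨a, Part.mem_some a, h⟩

theorem isBelow_of_mem {e : Part A} {a : A} (h : a ∈ e) : IsBelow e a := ⟨a, h, le_rfl⟩

theorem IsBelow.mem (hA : IsDiscrete A) {e : Part A} {a : A} (h : IsBelow e a) : a ∈ e := by
  obtain ⟨x, hx, hxa⟩ := h
  exact hA _ _ hxa ▸ hx

theorem IsBelow.refines {e : Part A} {a : A} (h : IsBelow e a) : Refines e (Part.some a) := by
  intro b hb
  obtain rfl := Part.mem_some_iff.1 hb
  exact h

end Kleene

/-! ### Computable terms, fixed points, pairing and case distinction in a PCA. -/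

section Combinators

variable {A : Type u} [PartialOrder A] [PCA A]

open PCA (k s)

theorem IsBelow.papp {e e' : Part A} {a b c : A} (h : IsBelow e a) (h' : IsBelow e' b)
    (hc : IsBelow (a ⬝ b) c) : IsBelow (papp e e') c :=
  IsBelow.mono (papp_mono h.refines h'.refines) (by rwa [papp_some])

theorem IsBelow.papp₂ {e e₁ e₂ : Part A} {a b₁ b₂ c : A} (h : IsBelow e a) (h₁ : IsBelow e₁ b₁)
    (h₂ : IsBelow e₂ b₂) (hc : IsBelow (RelPCA.papp (a ⬝ b₁) (Part.some b₂)) c) :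
    IsBelow (RelPCA.papp (RelPCA.papp e e₁) e₂) c := by
  refine IsBelow.mono (papp_mono (papp_mono h.refines h₁.refines) h₂.refines) ?_
  rwa [papp_some]

theorem sharp_app {a b c : A} (ha : a ∈ PCA.sharp (A := A)) (hb : b ∈ PCA.sharp (A := A))
    (hc : c ∈ a ⬝ b) : c ∈ PCA.sharp (A := A) :=
  PCA.sharp_isFilter.app_mem a ha b hb c hc

theorem sharp_papp {e e' : Part A} (h : ∀ a ∈ e, a ∈ PCA.sharp (A := A))
    (h' : ∀ a ∈ e', a ∈ PCA.sharp (A := A)) : ∀ c ∈ papp e e', c ∈ PCA.sharp (A := A) := by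
  intro c hc
  obtain ⟨x, hx, y, hy, hxy⟩ := mem_papp.1 hc
  exact sharp_app (h x hx) (h' y hy) hxy

theorem sharp_some {a : A} (h : a ∈ PCA.sharp (A := A)) :
    ∀ c ∈ Part.some a, c ∈ PCA.sharp (A := A) := by
  intro c hc
  obtain rfl := Part.mem_some_iff.1 hc
  exact h

theorem tt_sharp : tt A ∈ PCA.sharp (A := A) := PCA.k_mem

theorem iC_sharp : iC A ∈ PCA.sharp (A := A) :=
  sharp_papp (fun _ => sharp_app PCA.s_mem PCA.k_mem) (sharp_some PCA.k_mem) _ (Part.get_mem _)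

theorem ff_sharp : ff A ∈ PCA.sharp (A := A) :=
  sharp_app PCA.k_mem iC_sharp (Part.get_mem _)

/-- All constants of the term are computable. -/
def Term.IsSharp : Term A → Prop
  | .var _ => True
  | .const a => a ∈ PCA.sharp (A := A)
  | .app t₀ t₁ => t₀.IsSharp ∧ t₁.IsSharp

theorem Term.isSharp_var (n : ℕ) : (Term.var n : Term A).IsSharp := trivial

theorem Term.IsSharp.lam {t : Term A} (h : t.IsSharp) (x : ℕ) : (t.lam x).IsSharp := by
  induction t with
  | var n =>
    by_cases hn : n = x
    · simpa [Term.lam, hn, Term.IsSharp] using iC_sharp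
    · simpa [Term.lam, hn, Term.IsSharp] using PCA.k_mem
  | const a => exact ⟨PCA.k_mem, h⟩
  | app t₀ t₁ h₀ h₁ => exact ⟨⟨PCA.s_mem, h₀ h.1⟩, h₁ h.2⟩

theorem Term.IsSharp.eval {t : Term A} (h : t.IsSharp) {ρ : ℕ → A}
    (hρ : ∀ n, ρ n ∈ PCA.sharp (A := A)) : ∀ c ∈ t.eval ρ, c ∈ PCA.sharp (A := A) := by
  induction t with
  | var n => exact sharp_some (hρ n)
  | const a => exact sharp_some h
  | app t₀ t₁ h₀ h₁ => exact sharp_papp (h₀ h.1) (h₁ h.2)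

theorem lamC_sharp {x : ℕ} {t : Term A} (h : t.IsSharp) : lamC x t ∈ PCA.sharp (A := A) :=
  (h.lam x).eval (fun _ => PCA.k_mem) _ (Part.get_mem _)

theorem lamC_app (x : ℕ) (t : Term A) (a : A) :
    Refines (lamC x t ⬝ a) (t.eval (Function.update (fun _ => k) x a)) := by
  have h := Term.eval_lam_app (fun _ => k) x t a
  have hm : lamC x t ∈ (t.lam x).eval fun _ => k := Part.get_mem _
  rwa [Part.eq_some_iff.2 hm, papp_some] at h

theorem exists_lam {t : Term A} (h : t.IsSharp) : ∃ e ∈ PCA.sharp (A := A), ∀ a,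
    Refines (e ⬝ a) (t.eval (Function.update (fun _ => k) 0 a)) :=
  ⟨lamC 0 t, lamC_sharp h, lamC_app 0 t⟩

/-- Definedness of `e ⬝ a` is stated separately because `Refines` says nothing where the body is
undefined; it holds since `e ⬝ a` refines an abstraction, and abstractions always denote. -/
theorem exists_lam₂ {t : Term A} (h : t.IsSharp) : ∃ e ∈ PCA.sharp (A := A), ∀ a, (e ⬝ a).Dom ∧
    ∀ b, Refines (papp (e ⬝ a) (Part.some b))
      (t.eval (Function.update (Function.update (fun _ => k) 0 a) 1 b)) :=
  ⟨lamC 0 (t.lam 1), lamC_sharp (h.lam 1), fun a =>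
    ⟨(lamC_app 0 (t.lam 1) a).dom (Term.eval_lam_dom _ _ _), fun b =>
      (papp_mono (lamC_app 0 (t.lam 1) a) Refines.rfl).trans (Term.eval_lam_app _ 1 t b)⟩⟩

/-- The fixed point is `z = ww` with `w = λ* x y. F (x x) y`. The inner abstraction over `y` delays
the self-application, so `ww` is defined. -/
theorem exists_fix {t : Term A} (h : t.IsSharp) : ∃ z ∈ PCA.sharp (A := A), ∀ a,
    Refines (z ⬝ a) (t.eval (Function.update (Function.update (fun _ => k) 0 z) 1 a)) := by
  obtain ⟨F, hF, hFt⟩ := exists_lam₂ h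
  obtain ⟨w, hw, hwF⟩ := exists_lam₂
    (t := .app (.app (.const F) (.app (.var 0) (.var 0))) (.var 1))
    ⟨⟨hF, trivial, trivial⟩, trivial⟩
  obtain ⟨z, hz⟩ := Part.dom_iff_mem.1 (hwF w).1
  refine ⟨z, sharp_app hw hw hz, fun a => ?_⟩
  have h1 := (hwF w).2 a
  simp only [Term.eval, Function.update_self, Function.update_of_ne (zero_ne_one (α := ℕ)),
    papp_some, Part.eq_some_iff.2 hz] at h1
  exact h1.trans ((hFt z).2 a)

theorem tt_app (a b : A) : IsBelow (papp (tt A ⬝ a) (Part.some b)) a := PCA.k_app a b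

theorem ff_app_dom (a : A) : IsBelow (ff A ⬝ a) (iC A) := by
  have h := PCA.k_app (iC A) a
  have hm : ff A ∈ k ⬝ iC A := Part.get_mem _
  rwa [Part.eq_some_iff.2 hm, papp_some] at h

theorem ff_app (a b : A) : IsBelow (papp (ff A ⬝ a) (Part.some b)) b :=
  (ff_app_dom a).papp (isBelow_some le_rfl) (i_app b)

theorem pair_app (a b c : A) :
    Refines (pair a b ⬝ c) (papp (c ⬝ a) (Part.some b)) := by
  have h1 := lamC_app 0 (.lam 1 (.lam 2 (.app (.app (.var 2) (.var 0)) (.var 1)))) a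
  have h2 := (papp_mono h1 (Refines.rfl (e := Part.some b))).trans
    (Term.eval_lam_app _ 1 (.lam 2 (.app (.app (.var 2) (.var 0)) (.var 1))) b)
  have h3 := (papp_mono h2 (Refines.rfl (e := Part.some c))).trans (Term.eval_lam_app _ 2 _ c)
  have hm : pair a b ∈ papp (pC A ⬝ a) (Part.some b) := Part.get_mem _
  rw [pC] at hm
  rw [Part.eq_some_iff.2 hm, papp_some] at h3
  simpa [Term.eval, papp_some, Function.update] using h3

theorem p₀_app (c : A) : Refines (p₀ A ⬝ c) (c ⬝ tt A) := by
  simpa [p₀, Term.eval, papp_some, Function.update] using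
    lamC_app 0 (.app (.var 0) (.const (tt A))) c

theorem p₁_app (c : A) : Refines (p₁ A ⬝ c) (c ⬝ ff A) := by
  simpa [p₁, Term.eval, papp_some, Function.update] using
    lamC_app 0 (.app (.var 0) (.const (ff A))) c

theorem p₀_pair (a b : A) : IsBelow (p₀ A ⬝ pair a b) a :=
  (tt_app a b).mono ((p₀_app _).trans (pair_app a b _))

theorem p₁_pair (a b : A) : IsBelow (p₁ A ⬝ pair a b) b :=
  (ff_app a b).mono ((p₁_app _).trans (pair_app a b _))

/-- Since `0` is coded by `i` and `n + 1` by `p ⊥ n`, this makes `p₀` a zero test on numerals. -/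
theorem p₀_i : IsBelow (p₀ A ⬝ iC A) (tt A) := (i_app _).mono (p₀_app _)

theorem pC_sharp : pC A ∈ PCA.sharp (A := A) :=
  lamC_sharp (Term.IsSharp.lam
    (Term.IsSharp.lam (t := .app (.app _ _) _)
      ⟨⟨Term.isSharp_var 2, Term.isSharp_var 0⟩, Term.isSharp_var 1⟩ 2) 1)

theorem p₀_sharp : p₀ A ∈ PCA.sharp (A := A) := lamC_sharp ⟨trivial, tt_sharp⟩

theorem p₁_sharp : p₁ A ∈ PCA.sharp (A := A) := lamC_sharp ⟨trivial, ff_sharp⟩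

theorem pair_sharp {a b : A} (ha : a ∈ PCA.sharp (A := A)) (hb : b ∈ PCA.sharp (A := A)) :
    pair a b ∈ PCA.sharp (A := A) :=
  sharp_papp (fun _ => sharp_app pC_sharp ha) (sharp_some hb) _ (Part.get_mem _)

namespace Term

/-- The term `p t t'`. -/
def mkPair (t t' : Term A) : Term A := .app (.app (.const (pC A)) t) t'

/-- The term `p₀ t`. -/
def fst (t : Term A) : Term A := .app (.const (p₀ A)) t

/-- The term `p₁ t`. -/
def snd (t : Term A) : Term A := .app (.const (p₁ A)) t

/-- The term `b (λ* x. t) (λ* x. t') k`: a case distinction that evaluates only the chosen branch,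
when `x` does not occur in `t`, `t'`. -/
def ite (x : ℕ) (b t t' : Term A) : Term A := .app (.app (.app b (t.lam x)) (t'.lam x)) (.const k)

variable {t t' t'' : Term A}

theorem IsSharp.mkPair (h : t.IsSharp) (h' : t'.IsSharp) : (t.mkPair t').IsSharp :=
  ⟨⟨pC_sharp, h⟩, h'⟩

theorem IsSharp.fst (h : t.IsSharp) : t.fst.IsSharp := ⟨p₀_sharp, h⟩

theorem IsSharp.snd (h : t.IsSharp) : t.snd.IsSharp := ⟨p₁_sharp, h⟩

theorem IsSharp.ite (h : t.IsSharp) (h' : t'.IsSharp) (h'' : t''.IsSharp) (x : ℕ) :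
    (Term.ite x t t' t'').IsSharp :=
  ⟨⟨⟨h, h'.lam x⟩, h''.lam x⟩, PCA.k_mem⟩

variable {ρ : ℕ → A} {a b c : A}

theorem isBelow_var {n : ℕ} (h : ρ n = a) : IsBelow ((Term.var n).eval ρ) a :=
  isBelow_some h.le

theorem isBelow_const : IsBelow ((Term.const a).eval ρ) a := isBelow_some le_rfl

theorem isBelow_app (h : IsBelow (t.eval ρ) a) (h' : IsBelow (t'.eval ρ) b)
    (hc : IsBelow (a ⬝ b) c) : IsBelow ((Term.app t t').eval ρ) c :=
  h.papp h' hc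

theorem isBelow_app₂ {d : A} (h : IsBelow (t.eval ρ) a) (h' : IsBelow (t'.eval ρ) b)
    (h'' : IsBelow (t''.eval ρ) c) (hc : IsBelow (papp (a ⬝ b) (Part.some c)) d) :
    IsBelow ((Term.app (.app t t') t'').eval ρ) d :=
  h.papp₂ h' h'' hc

theorem isBelow_mkPair (h : IsBelow (t.eval ρ) a) (h' : IsBelow (t'.eval ρ) b) :
    IsBelow ((t.mkPair t').eval ρ) (pair a b) :=
  isBelow_app₂ isBelow_const h h' (isBelow_of_mem (Part.get_mem _))

theorem isBelow_fst (h : IsBelow (t.eval ρ) (pair a b)) : IsBelow (t.fst.eval ρ) a :=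
  isBelow_app isBelow_const h (p₀_pair a b)

theorem isBelow_snd (h : IsBelow (t.eval ρ) (pair a b)) : IsBelow (t.snd.eval ρ) b :=
  isBelow_app isBelow_const h (p₁_pair a b)

theorem isBelow_lam_app {x : ℕ} {v : A} (hv : v ∈ (t.lam x).eval ρ)
    (h : IsBelow (t.eval (Function.update ρ x c)) a) : IsBelow (v ⬝ c) a := by
  have h1 := Term.eval_lam_app ρ x t c
  rw [Part.eq_some_iff.2 hv, papp_some] at h1
  exact h.mono h1

/-- Nothing is required of the other branch, as its abstraction denotes in any case. Recursive
definitions rely on this: the recursive call may diverge once the dialogue has ended. -/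
theorem isBelow_ite_tt {x : ℕ} (h : IsBelow (t.eval ρ) (tt A))
    (h' : IsBelow (t'.eval (Function.update ρ x k)) c) :
    IsBelow ((Term.ite x t t' t'').eval ρ) c := by
  obtain ⟨v, hv⟩ := Part.dom_iff_mem.1 (Term.eval_lam_dom ρ x t')
  obtain ⟨v', hv'⟩ := Part.dom_iff_mem.1 (Term.eval_lam_dom ρ x t'')
  exact isBelow_app (isBelow_app₂ h (isBelow_of_mem hv) (isBelow_of_mem hv') (tt_app v v'))
    isBelow_const (isBelow_lam_app hv h')

theorem isBelow_ite_ff {x : ℕ} (h : IsBelow (t.eval ρ) (ff A))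
    (h' : IsBelow (t''.eval (Function.update ρ x k)) c) :
    IsBelow ((Term.ite x t t' t'').eval ρ) c := by
  obtain ⟨v, hv⟩ := Part.dom_iff_mem.1 (Term.eval_lam_dom ρ x t')
  obtain ⟨v', hv'⟩ := Part.dom_iff_mem.1 (Term.eval_lam_dom ρ x t'')
  exact isBelow_app (isBelow_app₂ h (isBelow_of_mem hv) (isBelow_of_mem hv') (ff_app v v'))
    isBelow_const (isBelow_lam_app hv' h')

end Term

/-! ### Encoded dialogue histories and single queries. -/

/-- `σ` is a pair of the length of `l` and a function that prepends `l` to tuples. -/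
def IsListState (σ : A) (l : List A) : Prop :=
  ∃ D, σ = pair (num A l.length) D ∧ ∀ l', IsBelow (D ⬝ tuple l') (tuple (l ++ l'))

variable (A) in
theorem exists_initState (hA : IsDiscrete A) : ∃ e ∈ PCA.sharp (A := A), ∀ a,
    ∃ σ ∈ e ⬝ a, IsListState σ [a] := by
  obtain ⟨e, he, h⟩ := exists_lam
    (t := .mkPair (.const (num A 1)) (.app (.const (pC A)) (.var 0)))
    (Term.IsSharp.mkPair (pair_sharp ff_sharp iC_sharp) ⟨pC_sharp, trivial⟩)
  refine ⟨e, he, fun a => ?_⟩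
  have hm : ∀ b, pair a b ∈ papp (pC A ⬝ a) (Part.some b) := fun b => Part.get_mem _
  obtain ⟨D, hD, -⟩ := mem_papp.1 (hm a)
  refine ⟨pair (num A 1) D, IsBelow.mem hA (IsBelow.mono (h a) ?_), D, rfl, fun l' => ?_⟩
  · exact Term.isBelow_mkPair Term.isBelow_const
      (Term.isBelow_app Term.isBelow_const (Term.isBelow_var (Function.update_self _ _ _))
        (isBelow_of_mem hD))
  · have := hm (tuple l')
    rw [Part.eq_some_iff.2 hD, papp_some] at this
    exact isBelow_of_mem this

variable (A) in
theorem exists_codeState (hA : IsDiscrete A) : ∃ e ∈ PCA.sharp (A := A), ∀ σ l,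
    IsListState σ l → code l ∈ e ⬝ σ := by
  obtain ⟨e, he, h⟩ := exists_lam (A := A)
    (t := .mkPair (.fst (.var 0)) (.app (.snd (.var 0)) (.const (iC A))))
    (Term.IsSharp.mkPair (Term.IsSharp.fst trivial) ⟨Term.IsSharp.snd trivial, iC_sharp⟩)
  refine ⟨e, he, ?_⟩
  rintro _ l ⟨D, rfl, hD⟩
  refine IsBelow.mem hA (IsBelow.mono (h _) ?_)
  have h0 := Term.isBelow_var
    (Function.update_self 0 (pair (num A l.length) D) (fun _ : ℕ => (k : A)))
  refine Term.isBelow_mkPair (Term.isBelow_fst h0)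
    (Term.isBelow_app (Term.isBelow_snd h0) Term.isBelow_const ?_)
  -- The empty tuple is `i`, so applying the prepending function to `i` returns the tuple of `l`.
  simpa [tuple] using hD []

variable (A) in
-- Tuples are nested to the right, so appending to one directly would need a recursion on its
-- length. For the prepending function it is a composition: `l'` is sent to `D (p u l')`.
theorem exists_stepState (hA : IsDiscrete A) : ∃ e ∈ PCA.sharp (A := A), ∀ σ l u,
    IsListState σ l → ∃ e' ∈ e ⬝ σ, ∃ σ' ∈ e' ⬝ u, IsListState σ' (l ++ [u]) := by
  obtain ⟨e, he, h⟩ := exists_lam₂ (A := A)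
    (t := .mkPair (.mkPair (.const (ff A)) (.fst (.var 0)))
      (.lam 2 (.app (.snd (.var 0)) (.mkPair (.var 1) (.var 2)))))
    (Term.IsSharp.mkPair (Term.IsSharp.mkPair ff_sharp (Term.IsSharp.fst trivial))
      (Term.IsSharp.lam (t := .app _ _)
        ⟨.snd (Term.isSharp_var 0), .mkPair (Term.isSharp_var 1) (Term.isSharp_var 2)⟩ 2))
  refine ⟨e, he, ?_⟩
  rintro _ l u ⟨D, rfl, hD⟩
  set σ := pair (num A l.length) D with hσ
  obtain ⟨e', he'⟩ := Part.dom_iff_mem.1 (h σ).1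
  have h' := (h σ).2 u
  rw [Part.eq_some_iff.2 he', papp_some] at h'
  set ρ := Function.update (Function.update (fun _ : ℕ => (k : A)) 0 σ) 1 u with hρ
  obtain ⟨D', hD'⟩ := Part.dom_iff_mem.1 (Term.eval_lam_dom ρ 2
    (.app (.snd (.var 0)) (.mkPair (.var 1) (.var 2))))
  refine ⟨e', he', pair (pair (ff A) (num A l.length)) D',
    IsBelow.mem hA (IsBelow.mono h' ?_), D', ?_, fun l' => ?_⟩
  · exact Term.isBelow_mkPair
      (Term.isBelow_mkPair Term.isBelow_const (Term.isBelow_fst (Term.isBelow_var rfl)))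
      (isBelow_of_mem hD')
  · simp [num]
  · refine Term.isBelow_lam_app hD' (Term.isBelow_app (Term.isBelow_snd (Term.isBelow_var rfl))
      (Term.isBelow_mkPair (Term.isBelow_var rfl) (Term.isBelow_var rfl)) ?_)
    simpa [Function.update, hρ, tuple] using hD (u :: l')

variable (A) in
/-- An element representing one single call to the oracle, on the pair of `r` and the input. -/
theorem exists_query (hA : IsDiscrete A) {r : A} (hr : r ∈ PCA.sharp (A := A)) :
    ∃ m ∈ PCA.sharp (A := A), ∀ a, pair (ff A) (pair r a) ∈ m ⬝ code [a] ∧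
      ∀ u, pair (tt A) u ∈ m ⬝ code [a, u] := by
  obtain ⟨m, hm, h⟩ := exists_lam (A := A)
    -- The Boolean `p₀ (p₁ (p₀ x))` tests whether the length minus one is zero: true on `[a]`, where
    -- the query is issued, and false on `[a, u]`, where the answer `u` is returned.
    (t := .app (.app (.fst (.snd (.fst (.var 0))))
      (.mkPair (.const (ff A)) (.mkPair (.const r) (.fst (.snd (.var 0))))))
      (.mkPair (.const (tt A)) (.fst (.snd (.snd (.var 0))))))
    ⟨⟨.fst (.snd (.fst trivial)), .mkPair ff_sharp (.mkPair hr (.fst (.snd trivial)))⟩,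
      .mkPair tt_sharp (.fst (.snd (.snd trivial)))⟩
  refine ⟨m, hm, fun a => ⟨IsBelow.mem hA (IsBelow.mono (h _) ?_),
    fun u => IsBelow.mem hA (IsBelow.mono (h _) ?_)⟩⟩
  · have h0 := Term.isBelow_var
      (Function.update_self 0 (code [a]) (fun _ : ℕ => (k : A)))
    exact Term.isBelow_app₂
      (Term.isBelow_app Term.isBelow_const (Term.isBelow_snd (Term.isBelow_fst h0)) p₀_i)
      (Term.isBelow_mkPair Term.isBelow_const (Term.isBelow_mkPair Term.isBelow_const
        (Term.isBelow_fst (Term.isBelow_snd h0))))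
      -- The rejected branch is evaluated too. On `[a]` it reads past the end of the tuple, which is
      -- harmless because the tuple ends in `i` and `p₀ i` is defined.
      (Term.isBelow_mkPair Term.isBelow_const (Term.isBelow_app Term.isBelow_const
        (Term.isBelow_snd (Term.isBelow_snd h0)) p₀_i)) (tt_app _ _)
  · have h0 := Term.isBelow_var
      (Function.update_self 0 (code [a, u]) (fun _ : ℕ => (k : A)))
    exact Term.isBelow_app₂
      (Term.isBelow_fst (Term.isBelow_snd (Term.isBelow_fst h0)))
      (Term.isBelow_mkPair Term.isBelow_const (Term.isBelow_mkPair Term.isBelow_const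
        (Term.isBelow_fst (Term.isBelow_snd h0))))
      (Term.isBelow_mkPair Term.isBelow_const
        (Term.isBelow_fst (Term.isBelow_snd (Term.isBelow_snd h0)))) (ff_app _ _)

end Combinators

/-! ### Elements of `𝓑A` over a discrete `A`, and reductions with one query. -/

section BFun

variable {A : Type u} [PartialOrder A]

/-- The element of `𝓑A` given by a functional relation, for `A` discrete. -/
noncomputable def BFun.ofRel (hA : IsDiscrete A) (R : A → A → Prop) : BFun A where
  toFun a := ⟨∃ b, R a b, fun h => h.choose⟩
  mono a b h := by
    obtain rfl := hA a b h
    exact Refines.rfl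

theorem BFun.mem_ofRel {hA : IsDiscrete A} {R : A → A → Prop}
    (hR : ∀ a b b', R a b → R a b' → b = b') {a b : A} :
    b ∈ (BFun.ofRel hA R).toFun a ↔ R a b := by
  constructor
  · rintro ⟨h, rfl⟩
    exact h.choose_spec
  · exact fun h => ⟨⟨b, h⟩, hR _ _ _ (Exists.choose_spec (⟨b, h⟩ : ∃ b, R a b)) h⟩

theorem BFun.mem_of_le (hA : IsDiscrete A) {α β : BFun A} (h : α ≤ β) {a c : A}
    (hc : c ∈ β.toFun a) : c ∈ α.toFun a := by
  obtain ⟨c', hc', hle⟩ := h a c hc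
  exact hA _ _ hle ▸ hc'

variable [PCA A]

/-- The element of `𝓑A` represented by `m`. -/
def BFun.ofElem (m : A) : BFun A where
  toFun a := m ⬝ a
  mono _ _ h := PAP.app_mono le_rfl h

theorem BFun.ofElem_mem_sharp {m : A} (hm : m ∈ PCA.sharp (A := A)) :
    BFun.ofElem m ∈ BFun.sharp A :=
  ⟨m, hm, fun _ => Refines.rfl⟩

/-- A filter that contains `f` and `(𝓑A)^#` contains every function extended by
`a ↦ f(pra)`. -/
theorem mem_of_pair [NonSemitrivial A] (hA : IsDiscrete A) {F : Set (BFun A)} (hF : IsFilter F)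
    (hsharp : BFun.sharp A ⊆ F) {f α : BFun A} (hf : f ∈ F) {r : A}
    (hr : r ∈ PCA.sharp (A := A)) (h : ∀ a, ∀ c ∈ α.toFun a, c ∈ f.toFun (pair r a)) : α ∈ F := by
  obtain ⟨m, hm, hmq⟩ := exists_query A hA hr
  refine hF.upward _ (hF.app_mem _ (hsharp (BFun.ofElem_mem_sharp hm)) _ hf _ (Part.mem_some _)) _ ?_
  intro a c hc
  refine ⟨c, mem_bappFun.2 ⟨[c], ?_, _, (hmq a).2 c, p₀_pair _ _, (p₁_pair _ _).mem hA⟩, le_rfl⟩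
  intro i hi
  obtain rfl : i = 0 := by simpa using hi
  exact ⟨_, (hmq a).1, p₀_pair _ _, _, (p₁_pair _ _).mem hA, h a c hc⟩

end BFun

/-! ### The theorem for morphisms given by a single function `γ`. -/

section PointMorphisms

variable {A : Type u} {B : Type v} [PartialOrder A] [PCA A] [PartialOrder B] [PCA B]

/-- The properties of a function `γ` for which `a ↦ ↓{γ(a)}` is a discrete and computationally
dense applicative morphism. -/
structure IsPointMorphism (γ : A → B) : Prop where
  sharp : ∀ a ∈ PCA.sharp (A := A), γ a ∈ PCA.sharp (A := B)
  tracker : ∃ t ∈ PCA.sharp (A := B), ∀ a a' : A, ∀ c ∈ a ⬝ a',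
    IsBelow (papp (t ⬝ γ a) (Part.some (γ a'))) (γ c)
  discrete : ∀ a a' x, x ≤ γ a → x ≤ γ a' → a = a'
  dense : ∃ n ∈ PCA.sharp (A := B), ∀ s ∈ PCA.sharp (A := B), ∃ r ∈ PCA.sharp (A := A),
    IsBelow (n ⬝ γ r) s

/-- `s` represents `α` with respect to `a ↦ ↓{γ(a)}`. -/
def PointRepresents (γ : A → B) (s : B) (α : BFun A) : Prop :=
  ∀ a, ∀ c ∈ α.toFun a, IsBelow (s ⬝ γ a) (γ c)

variable (γ : A → B)

/-- The functions that are effectively representable with respect to `a ↦ ↓{γ(a)}`. -/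
def pointRepresentable : Set (BFun A) := {α | ∃ s ∈ PCA.sharp (A := B), PointRepresents γ s α}

variable {γ}

/-- Density supplies codes `r`, `r'` of the two Booleans of `B`. A Boolean `b` of `A` selects one of
them as `b r r'`; this selection is tracked in `B`, and `n` decodes the result. -/
theorem IsPointMorphism.decides (hA : IsDiscrete A) (hγ : IsPointMorphism γ) :
    ∃ d ∈ PCA.sharp (A := B),
      IsBelow (d ⬝ γ (tt A)) (tt B) ∧ IsBelow (d ⬝ γ (ff A)) (ff B) := by
  obtain ⟨t, ht, htr⟩ := hγ.tracker
  obtain ⟨n, hn, hd⟩ := hγ.dense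
  obtain ⟨r, hr, hrt⟩ := hd _ tt_sharp
  obtain ⟨r', hr', hrf⟩ := hd _ ff_sharp
  obtain ⟨m, hm, hmt⟩ := exists_lam (A := A) (t := .app (.app (.var 0) (.const r)) (.const r'))
    ⟨⟨trivial, hr⟩, hr'⟩
  obtain ⟨d, hd, hdt⟩ := exists_lam (A := B)
    (t := .app (.const n) (.app (.app (.const t) (.const (γ m))) (.var 0)))
    ⟨hn, ⟨ht, hγ.sharp m hm⟩, trivial⟩
  have key : ∀ b x y, IsBelow (papp (b ⬝ r) (Part.some r')) x → IsBelow (n ⬝ γ x) y →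
      IsBelow (d ⬝ γ b) y := by
    intro b x y hx hy
    have h1 : IsBelow (m ⬝ b) x := IsBelow.mono (hmt b)
      (Term.isBelow_app₂ (Term.isBelow_var rfl) Term.isBelow_const Term.isBelow_const hx)
    exact IsBelow.mono (hdt _) (Term.isBelow_app Term.isBelow_const
      (Term.isBelow_app₂ Term.isBelow_const Term.isBelow_const (Term.isBelow_var rfl)
        (htr _ _ _ (h1.mem hA))) hy)
  exact ⟨d, hd, key _ _ _ (tt_app r r') hrt, key _ _ _ (ff_app r r') hrf⟩

/-- The term for the recursive function that simulates in `B` the interrogation of an oracle tracked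
by `s'` by a function tracked by `s`. -/
def simulationTerm (γ : A → B) (d t s s' : B) (e e' : A) : Term B :=
  -- Variable 0 is the recursive function itself and variable 1 the image of the current history. `T
  -- h` tracks application of `h`, and `Y` is the image of the reply of `α` to that history.
  let T : A → Term B → Term B := fun h x => .app (.app (.const t) (.const (γ h))) x
  let Y : Term B := .app (.const s) (T e (.var 1))
  .ite 2 (.app (.const d) (T (p₀ A) Y)) (T (p₁ A) Y)
    (.app (.var 0)
      (.app (.app (.const t) (T e' (.var 1))) (.app (.const s') (T (p₁ A) Y))))

theorem bapp_mem_pointRepresentable [NonSemitrivial A] (hA : IsDiscrete A)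
    (hγ : IsPointMorphism γ) {α β : BFun A} (hα : α ∈ pointRepresentable γ)
    (hβ : β ∈ pointRepresentable γ) : bapp α β ∈ pointRepresentable γ := by
  obtain ⟨s, hs, hsα⟩ := hα
  obtain ⟨s', hs', hsβ⟩ := hβ
  obtain ⟨t, ht, htr⟩ := hγ.tracker
  obtain ⟨d, hd, hdt, hdf⟩ := hγ.decides hA
  obtain ⟨e₀, he₀, hinit⟩ := exists_initState A hA
  obtain ⟨e, he, hcode⟩ := exists_codeState A hA
  obtain ⟨e', he', hstep⟩ := exists_stepState A hA
  have track : ∀ {ρ : ℕ → B} {x y : Term B} {h a c : A}, c ∈ h ⬝ a → IsBelow (x.eval ρ) (γ h) →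
      IsBelow (y.eval ρ) (γ a) → IsBelow ((Term.app (.app (.const t) x) y).eval ρ) (γ c) :=
    fun hc hx hy => Term.isBelow_app₂ Term.isBelow_const hx hy (htr _ _ _ hc)
  obtain ⟨z, hz, hzt⟩ := exists_fix (t := simulationTerm γ d t s s' e e') (by
    have hT : ∀ {h : A} {x : Term B}, h ∈ PCA.sharp (A := A) → x.IsSharp →
        (Term.app (.app (.const t) (.const (γ h))) x).IsSharp :=
      fun hh hx => ⟨⟨ht, hγ.sharp _ hh⟩, hx⟩
    have hY : (Term.app (.const s) (.app (.app (.const t) (.const (γ e))) (.var 1))).IsSharp :=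
      ⟨hs, hT he trivial⟩
    refine Term.IsSharp.ite ?_ (hT p₁_sharp hY) ?_ 2
    · exact ⟨hd, hT p₀_sharp hY⟩
    · exact ⟨trivial, ⟨ht, hT he' trivial⟩, hs', hT p₁_sharp hY⟩)
  obtain ⟨w, hw, hwt⟩ := exists_lam (A := B)
    (t := .app (.const z) (.app (.app (.const t) (.const (γ e₀))) (.var 0)))
    ⟨hz, ⟨ht, hγ.sharp _ he₀⟩, trivial⟩
  refine ⟨w, hw, fun a b hb => ?_⟩
  obtain ⟨us, hus, c, hc, hct, hcb⟩ := mem_bappFun.1 hb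
  have answer : ∀ {ρ : ℕ → B} {σ : A} {l : List A} {c : A}, ρ 1 = γ σ → IsListState σ l →
      c ∈ α.toFun (code l) →
      IsBelow ((Term.app (.const s) (.app (.app (.const t) (.const (γ e))) (.var 1))).eval ρ)
        (γ c) :=
    fun hρ hσ hc => Term.isBelow_app Term.isBelow_const
      (track (hcode _ _ hσ) Term.isBelow_const (Term.isBelow_var hρ)) (hsα _ _ hc)
  -- The induction is on the number `m` of oracle answers still to come, which decreases with each
  -- recursive call.
  have sim : ∀ m i, m + i = us.length → ∀ σ, IsListState σ (a :: us.take i) →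
      IsBelow (z ⬝ γ σ) (γ b) := by
    intro m
    induction m with
    | zero =>
      intro i hi σ hσ
      obtain rfl : i = us.length := by omega
      rw [List.take_length] at hσ
      refine IsBelow.mono (hzt _) (Term.isBelow_ite_tt ?_ ?_)
      · exact Term.isBelow_app Term.isBelow_const
          -- Discreteness of `A` turns `p₀ · c ≤ ⊤` into an equality, so that the tracked value lies
          -- below `γ(⊤)` and can be decided.
          (track (hct.mem hA) Term.isBelow_const (answer rfl hσ hc)) hdt
      · exact track hcb Term.isBelow_const (answer rfl hσ hc)
    | succ m ih =>
      intro i hi σ hσ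
      obtain ⟨y, hy, hyf, q, hq, hqu⟩ := hus i (by omega)
      obtain ⟨e₁, he₁, σ', hσ', hl⟩ := hstep σ _ us[i] hσ
      refine IsBelow.mono (hzt _) (Term.isBelow_ite_ff ?_ ?_)
      · exact Term.isBelow_app Term.isBelow_const
          (track (hyf.mem hA) Term.isBelow_const (answer rfl hσ hy)) hdf
      · refine Term.isBelow_app (Term.isBelow_var rfl)
          (track hσ' (track he₁ Term.isBelow_const (Term.isBelow_var rfl))
            (Term.isBelow_app Term.isBelow_const
              (track hq Term.isBelow_const (answer rfl hσ hy)) (hsβ _ _ hqu)))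
          (ih (i + 1) (by omega) σ' ?_)
        rwa [List.take_succ_eq_append_getElem (by omega)]
  obtain ⟨σ, hσ, hl⟩ := hinit a
  exact IsBelow.mono (hwt _) (Term.isBelow_app Term.isBelow_const
    (track hσ Term.isBelow_const (Term.isBelow_var rfl)) (sim us.length 0 (by omega) σ (by simpa)))

theorem sharp_subset_pointRepresentable (hA : IsDiscrete A) (hγ : IsPointMorphism γ) :
    BFun.sharp A ⊆ pointRepresentable γ := by
  rintro α ⟨r, hr, hrα⟩
  obtain ⟨t, ht, htr⟩ := hγ.tracker
  obtain ⟨w, hw, hwt⟩ := exists_lam (A := B)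
    (t := .app (.app (.const t) (.const (γ r))) (.var 0)) ⟨⟨ht, hγ.sharp _ hr⟩, trivial⟩
  exact ⟨w, hw, fun a c hc => IsBelow.mono (hwt _) (Term.isBelow_app₂ Term.isBelow_const
    Term.isBelow_const (Term.isBelow_var rfl) (htr _ _ _ (IsBelow.mem hA (hrα a c hc))))⟩

theorem isFilter_pointRepresentable [NonSemitrivial A] (hA : IsDiscrete A)
    (hγ : IsPointMorphism γ) : IsFilter (pointRepresentable γ) where
  nonempty := ⟨_, sharp_subset_pointRepresentable hA hγ (BFun.ofElem_mem_sharp tt_sharp)⟩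
  app_mem α hα β hβ δ hδ := by
    obtain rfl := Part.mem_some_iff.1 hδ
    exact bapp_mem_pointRepresentable hA hγ hα hβ
  upward := by
    rintro α ⟨s, hs, hsα⟩ β h
    exact ⟨s, hs, fun a c hc => hsα a c (BFun.mem_of_le hA h hc)⟩

theorem exists_pointRepresentable_eq_filterGen [NonSemitrivial A] (hA : IsDiscrete A)
    (hγ : IsPointMorphism γ) :
    ∃ f : BFun A, pointRepresentable γ = filterGen (BFun.sharp A ∪ {f}) := by
  obtain ⟨t, ht, htr⟩ := hγ.tracker
  obtain ⟨n, hn, hdense⟩ := hγ.dense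
  -- The graph of the universal function. It is functional because one value of `n · γ(r) · γ(a)`
  -- cannot lie below both `γ(c)` and `γ(c')` for distinct `c`, `c'`.
  let R : A → A → Prop := fun x c => ∃ r ∈ p₀ A ⬝ x, ∃ a ∈ p₁ A ⬝ x,
    IsBelow (papp (n ⬝ γ r) (Part.some (γ a))) (γ c)
  have hR : ∀ a b b', R a b → R a b' → b = b' := by
    rintro x c c' ⟨r, hr, a, ha, y, hy, hyc⟩ ⟨r', hr', a', ha', y', hy', hyc'⟩
    obtain rfl := Part.mem_unique hr hr'
    obtain rfl := Part.mem_unique ha ha'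
    obtain rfl := Part.mem_unique hy hy'
    exact hγ.discrete _ _ _ hyc hyc'
  refine ⟨BFun.ofRel hA R, Set.Subset.antisymm ?_ ?_⟩
  · rintro α ⟨s, hs, hsα⟩ F ⟨hF, hXF⟩
    obtain ⟨r, hr, hrs⟩ := hdense s hs
    refine mem_of_pair hA hF (Set.subset_union_left.trans hXF)
      (hXF (Set.mem_union_right _ rfl)) hr fun a c hc => (BFun.mem_ofRel hR).2 ?_
    exact ⟨r, (p₀_pair r a).mem hA, a, (p₁_pair r a).mem hA,
      hrs.papp (isBelow_some le_rfl) (hsα a c hc)⟩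
  · refine Set.sInter_subset_of_mem ⟨isFilter_pointRepresentable hA hγ,
      Set.union_subset (sharp_subset_pointRepresentable hA hγ) ?_⟩
    rintro _ rfl
    obtain ⟨w, hw, hwt⟩ := exists_lam (A := B)
      (t := .app (.app (.const n) (.app (.app (.const t) (.const (γ (p₀ A)))) (.var 0)))
        (.app (.app (.const t) (.const (γ (p₁ A)))) (.var 0)))
      ⟨⟨hn, ⟨ht, hγ.sharp _ p₀_sharp⟩, trivial⟩, ⟨ht, hγ.sharp _ p₁_sharp⟩, trivial⟩
    refine ⟨w, hw, fun x c hc => ?_⟩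
    obtain ⟨r, hr, a, ha, h⟩ := (BFun.mem_ofRel hR).1 hc
    exact IsBelow.mono (hwt _) (Term.isBelow_app₂ Term.isBelow_const
      (Term.isBelow_app₂ Term.isBelow_const Term.isBelow_const (Term.isBelow_var rfl)
        (htr _ _ _ hr))
      (Term.isBelow_app₂ Term.isBelow_const Term.isBelow_const (Term.isBelow_var rfl)
        (htr _ _ _ ha)) h)

end PointMorphisms

/-! ### Reduction of a projective morphism to a function `γ`. -/

section Projective

variable {A : Type u} {B : Type v} [PartialOrder A] [PCA A] [PartialOrder B] [PCA B]

/-- Although `dapp` applies the whole downset of `b`, monotonicity of application and downward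
closure of `Y` leave only `b` itself to be checked. -/
theorem isBelow_dapp_iff {b : B} {X Y : LowerSet B} :
    IsBelow (dapp b X) Y ↔ ∀ x ∈ X, ∃ y ∈ b ⬝ x, y ∈ Y := by
  constructor
  · rintro ⟨_, ⟨hd, rfl⟩, hle⟩ x hx
    have hb := hd b (LowerSet.mem_Iic_iff.2 le_rfl) x hx
    exact ⟨_, Part.get_mem hb, hle (subset_lowerClosure
      ⟨b, LowerSet.mem_Iic_iff.2 le_rfl, x, hx, Part.get_mem hb⟩)⟩
  · intro h
    have key : ∀ b' ≤ b, ∀ x ∈ X, ∃ y ∈ b' ⬝ x, y ∈ Y := by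
      intro b' hb' x hx
      obtain ⟨y, hy, hyY⟩ := h x hx
      obtain ⟨y', hy', hle⟩ := PAP.app_mono hb' le_rfl y hy
      exact ⟨y', hy', Y.lower hle hyY⟩
    refine ⟨_, ⟨fun b' hb' x hx => ?_, rfl⟩, ?_⟩
    · obtain ⟨y, hy, -⟩ := key b' hb' x hx
      exact Part.dom_iff_mem.2 ⟨y, hy⟩
    · refine lowerClosure_min ?_ Y.lower
      rintro c ⟨b', hb', x, hx, hc⟩
      obtain ⟨y, hy, hyY⟩ := key b' hb' x hx
      exact Part.mem_unique hc hy ▸ hyY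

theorem isBelow_papp_dapp {b : B} {X Y Z : LowerSet B}
    (h : IsBelow (papp (dapp b X) (Part.some Y)) Z) {x y : B} (hx : x ∈ X) (hy : y ∈ Y) :
    ∃ z ∈ papp (b ⬝ x) (Part.some y), z ∈ Z := by
  obtain ⟨W, hW, hWZ⟩ := h
  obtain ⟨V, hV, Y', hY', hVW⟩ := mem_papp.1 hW
  obtain rfl := Part.mem_some_iff.1 hY'
  obtain ⟨v, hv, hvV⟩ := isBelow_dapp_iff.1 ⟨V, hV, le_rfl⟩ x hx
  obtain ⟨hd, rfl⟩ := hVW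
  have hvy := hd v hvV y hy
  exact ⟨_, mem_papp.2 ⟨v, hv, y, Part.mem_some y, Part.get_mem hvy⟩,
    hWZ (subset_lowerClosure ⟨v, hvV, y, hy, Part.get_mem hvy⟩)⟩

namespace PartialApplicativeMorphism

/-- The realizers `s₁` and `s₂` of the isomorphism translate between elements of `g(a)` and elements
below `γ(a)`. Composing with them carries density and representing elements across. -/
theorem exists_isPointMorphism {g : PartialApplicativeMorphism A B} (htotal : g.IsTotal)
    (hdisc : g.IsDiscreteMorphism) (hproj : g.IsProjective) (hcd : g.IsCD) :
    ∃ γ : A → B, IsPointMorphism γ ∧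
      {α : BFun A | g.EffectivelyRepresentable α} = pointRepresentable γ := by
  obtain ⟨g', hsv, ⟨s₁, hs₁, h₁⟩, ⟨s₂, hs₂, h₂⟩⟩ := hproj
  have hne : ∀ a, ∃ b, g'.toFun a = LowerSet.Iic b := by
    intro a
    obtain ⟨x, hx⟩ := htotal a
    obtain ⟨y, -, hy⟩ := isBelow_dapp_iff.1 (h₁ a) x hx
    exact hsv a ⟨y, hy⟩
  choose γ hγ using hne
  have forth : ∀ a, ∀ x ∈ g.toFun a, IsBelow (s₁ ⬝ x) (γ a) := by
    intro a x hx
    obtain ⟨y, hy, hy'⟩ := isBelow_dapp_iff.1 (h₁ a) x hx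
    rw [hγ, LowerSet.mem_Iic_iff] at hy'
    exact ⟨y, hy, hy'⟩
  have back : ∀ a, ∀ x ≤ γ a, ∃ y ∈ s₂ ⬝ x, y ∈ g.toFun a := by
    intro a x hx
    refine isBelow_dapp_iff.1 (h₂ a) x ?_
    rwa [hγ, LowerSet.mem_Iic_iff]
  refine ⟨γ, ⟨?_, ?_, ?_, ?_⟩, Set.ext fun α => ⟨?_, ?_⟩⟩
  · intro a ha
    obtain ⟨x, hx, hxs⟩ := g'.sharp a ha
    rw [hγ] at hx
    exact PCA.sharp_isFilter.upward x hxs _ hx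
  · obtain ⟨t, ht, htr⟩ := g'.tracker
    refine ⟨t, ht, fun a a' c hc => ?_⟩
    obtain ⟨z, hz, hzc⟩ := isBelow_papp_dapp (htr a a' c hc) (x := γ a) (y := γ a')
      (by rw [hγ]; exact le_rfl) (by rw [hγ]; exact le_rfl)
    rw [hγ] at hzc
    exact ⟨z, hz, hzc⟩
  -- A common lower bound of `γ(a)` and `γ(a')` is sent by `s₂` to a single element of `g(a) ∩
  -- g(a')`.
  · intro a a' x hx hx'
    by_contra hne
    obtain ⟨y, hy, hya⟩ := back a x hx
    obtain ⟨y', hy', hya'⟩ := back a' x hx'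
    obtain rfl := Part.mem_unique hy hy'
    exact (Set.ext_iff.1 (hdisc a a' hne) y).1 ⟨hya, hya'⟩
  · obtain ⟨n, hn, hd⟩ := hcd
    obtain ⟨n', hn', hnt⟩ := exists_lam (A := B) (t := .app (.const n) (.app (.const s₂) (.var 0)))
      ⟨hn, hs₂, trivial⟩
    refine ⟨n', hn', fun s hs => ?_⟩
    obtain ⟨r, hr, hrs⟩ := hd s hs
    obtain ⟨y, hy, hyr⟩ := back r _ le_rfl
    exact ⟨r, hr, IsBelow.mono (hnt _) (Term.isBelow_app Term.isBelow_const
      (Term.isBelow_app Term.isBelow_const (Term.isBelow_var rfl) (isBelow_of_mem hy))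
      (isBelow_dapp_iff.1 hrs y hyr))⟩
  · rintro ⟨s, hs, hsα⟩
    obtain ⟨w, hw, hwt⟩ := exists_lam (A := B)
      (t := .app (.const s₁) (.app (.const s) (.app (.const s₂) (.var 0))))
      ⟨hs₁, hs, hs₂, trivial⟩
    refine ⟨w, hw, fun a c hc => ?_⟩
    obtain ⟨y, hy, hya⟩ := back a _ le_rfl
    obtain ⟨v, hv, hvc⟩ := isBelow_dapp_iff.1 (hsα a c hc) y hya
    exact IsBelow.mono (hwt _) (Term.isBelow_app Term.isBelow_const
      (Term.isBelow_app Term.isBelow_const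
        (Term.isBelow_app Term.isBelow_const (Term.isBelow_var rfl) (isBelow_of_mem hy))
        (isBelow_of_mem hv)) (forth c v hvc))
  · rintro ⟨s, hs, hsα⟩
    obtain ⟨w, hw, hwt⟩ := exists_lam (A := B)
      (t := .app (.const s₂) (.app (.const s) (.app (.const s₁) (.var 0))))
      ⟨hs₂, hs, hs₁, trivial⟩
    refine ⟨w, hw, fun a c hc => isBelow_dapp_iff.2 fun x hx => ?_⟩
    obtain ⟨y, hy, hyc⟩ := back c _ le_rfl
    obtain ⟨v, hv, hvy⟩ := IsBelow.mono (hwt x) (Term.isBelow_app Term.isBelow_const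
      (Term.isBelow_app Term.isBelow_const
        (Term.isBelow_app Term.isBelow_const (Term.isBelow_var rfl) (forth a x hx))
        (hsα a c hc)) (isBelow_of_mem hy))
    exact ⟨v, hv, (g.toFun c).lower hvy hyc⟩

end PartialApplicativeMorphism

end Projective

end RelPCA

theorem mainTheorem7 {A : Type u} {B : Type v} [PartialOrder A] [RelPCA.PCA A]
    [RelPCA.NonSemitrivial A] [PartialOrder B] [RelPCA.PCA B]
    (hA : RelPCA.IsDiscrete A) (g : RelPCA.PartialApplicativeMorphism A B)
    (htotal : g.IsTotal) (hdisc : g.IsDiscreteMorphism) (hproj : g.IsProjective)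
    (hcd : g.IsCD) :
    ∃ f : RelPCA.BFun A,
      {α : RelPCA.BFun A | g.EffectivelyRepresentable α} =
        RelPCA.filterGen (RelPCA.BFun.sharp A ∪ {f}) := by
  obtain ⟨γ, hγ, h⟩ := RelPCA.PartialApplicativeMorphism.exists_isPointMorphism htotal hdisc
    hproj hcd
  rw [h]
  exact RelPCA.exists_pointRepresentable_eq_filterGen hA hγ
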